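/- Let $N\ge 1$ be an integer, let $\mathbb T_N=\mathbb Z/N\mathbb Z$ be the discrete torus with $N$ sites, and let $\mathfrak s\ge 1/2$. On the configuration space $\Omega_N=\mathbb N_0^{\mathbb T_N}$, the Harmonic model with spin $\mathfrak s$ is the Markov process with generator $$L_N f(\eta)=\sum_{x\in\mathbb T_N}\big(\nabla_{x,x+1}f(\eta)+\nabla_{x+1,x}f(\eta)\big),\qquad \nabla_{x,y}f(\eta)=\sum_{k=1}^{\eta_x}\frac{\Gamma(\eta_x+1)\,\Gamma(\eta_x-k+2\mathfrak s)}{k\,\Gamma(\eta_x-k+1)\,\Gamma(\eta_x+2\mathfrak s)}\,\big[f(\eta-k\delta_x+k\delta_y)-f(\eta)\big],$$ where $\delta_x$ is the configuration with exactly one particle, located at $x$. That is, the model is a generalized zero-range process in which $k$ particles jump together from a site $x$ to a neighbouring site at a rate depending only on $\eta_x$ and $k$. For probability measures on $\Omega_N$, write $\mu_1\le\mu_2$ if $\int f\,d\mu_1\le\int f\,d\mu_2$ for every bounded function $f:\Omega_N\to\mathbb R$ that is monotone (nondecreasing) for the coordinatewise order. **Theorem (Attractiveness of the Harmonic models).**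 There is exactly one Markov semigroup $\{S(t):t\ge0\}$ on $\Omega_N$ with generator $L_N$, in the sense that $\lim_{t\downarrow0}\big(S(t)f(\eta)-f(\eta)\big)/t=L_Nf(\eta)$ for every bounded $f:\Omega_N\to\mathbb R$ and every $\eta\in\Omega_N$; and this semigroup is attractive: for all probability measures $\mu_1,\mu_2$ on $\Omega_N$ with $\mu_1\le\mu_2$, one has $S(t)\mu_1\le S(t)\mu_2$ for all $t\ge0$. -/

import Mathlib

open MeasureTheory ProbabilityTheory Filter Topology
open scoped NNReal

noncomputable section

namespace InteractingParticles

section MarkovSemigroups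

variable {Ω : Type*} [MeasurableSpace Ω]

/-- A Markov semigroup on `Ω`, given by its transition probabilities `S t η`, the law at time `t`
of the process started from `η`. It acts on an initial law `μ` by `S t ∘ₘ μ` (the law at time `t`)
and on a bounded function `f` by `η ↦ ∫ ξ, f ξ ∂(S t η)`. -/
structure IsMarkovSemigroup (S : ℝ≥0 → Kernel Ω Ω) : Prop where
  isMarkovKernel : ∀ t, IsMarkovKernel (S t)
  zero : S 0 = Kernel.id
  add : ∀ t u, S (t + u) = S u ∘ₖ S t

/-- The operator `L` is the infinitesimal generator of `S` on bounded measurable functions: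
`(S(t) f (η) - f (η)) / t → L f (η)` as `t ↓ 0`, for every state `η`. -/
def HasGenerator (S : ℝ≥0 → Kernel Ω Ω) (L : (Ω → ℝ) → Ω → ℝ) : Prop :=
  ∀ f : Ω → ℝ, Measurable f → (∃ C : ℝ, ∀ η, |f η| ≤ C) → ∀ η : Ω,
    Tendsto (fun t : ℝ≥0 => ((∫ ξ, f ξ ∂(S t η)) - f η) / (t : ℝ)) (𝓝[>] 0) (𝓝 (L f η))

variable [Preorder Ω]

/-- The partial order of probability measures (stochastic domination): `μ₁ ≤ μ₂` if
`E_{μ₁}[f] ≤ E_{μ₂}[f]` for every bounded (measurable) monotone function `f`. -/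
def StochLE (μ₁ μ₂ : Measure Ω) : Prop :=
  ∀ f : Ω → ℝ, Measurable f → (∃ C : ℝ, ∀ η, |f η| ≤ C) → Monotone f →
    ∫ η, f η ∂μ₁ ≤ ∫ η, f η ∂μ₂

/-- Attractiveness: `μ₁ ≤ μ₂` implies `S(t) μ₁ ≤ S(t) μ₂` for all `t ≥ 0`. -/
def IsAttractive (S : ℝ≥0 → Kernel Ω Ω) : Prop :=
  ∀ μ₁ μ₂ : Measure Ω, IsProbabilityMeasure μ₁ → IsProbabilityMeasure μ₂ →
    StochLE μ₁ μ₂ → ∀ t : ℝ≥0, StochLE (S t ∘ₘ μ₁) (S t ∘ₘ μ₂)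

end MarkovSemigroups

/-- Particle configurations on the discrete torus with `N` sites (`N ≥ 1`), with the product
σ-algebra (i.e. all subsets) and the coordinatewise order. -/
abbrev Config (N : ℕ) : Type := ZMod N → ℕ

/-- The rate at which `k` particles leave a site occupied by `n` particles towards a given
neighbour, for `1 ≤ k ≤ n` and spin `s`. -/
def harmonicRate (s : ℝ) (n k : ℕ) : ℝ :=
  (Real.Gamma ((n : ℝ) + 1) * Real.Gamma ((n : ℝ) - k + 2 * s)) /
    (k * Real.Gamma ((n : ℝ) - k + 1) * Real.Gamma ((n : ℝ) + 2 * s))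

/-- The configuration `η - k δ_x + k δ_y`; only used for `k ≤ η x`, where the subtraction of
natural numbers is the true one. -/
def jump {N : ℕ} (η : Config N) (x y : ZMod N) (k : ℕ) : Config N :=
  η - Pi.single x k + Pi.single y k

/-- The part of the generator that moves particles from the site `x` to the site `y`. -/
def harmonicNabla {N : ℕ} (s : ℝ) (x y : ZMod N) (f : Config N → ℝ) (η : Config N) : ℝ :=
  ∑ k ∈ Finset.Icc 1 (η x), harmonicRate s (η x) k * (f (jump η x y k) - f η)

/-- The generator of the harmonic model of spin `s` on the discrete torus with `N` sites. -/
def harmonicGenerator (N : ℕ) [NeZero N] (s : ℝ) (f : Config N → ℝ) (η : Config N) : ℝ :=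
  ∑ x : ZMod N, (harmonicNabla s x (x + 1) f η + harmonicNabla s (x + 1) x f η)

end InteractingParticles

end

/-! Jumps conserve the particle number, and each level set of it is finite. On a level set the
generator is a matrix with nonnegative off-diagonal entries and zero row sums; the exponentials of
these matrices assemble into a Markov semigroup (`IsJumpGenerator.exists_isMarkovSemigroup`).
Conversely, for any semigroup with this generator and any bounded `f`, the function `S(t) f` is
continuous in `t` and solves the backward equation `u' = L u`, which on each level set is a finite
linear ODE, hence uniqueness.

For attractiveness it suffices that `S(t)` preserves monotone functions, i.e. that `w(η, z) = S(t) f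
(η + δ_z) - S(t) f (η)` stays nonnegative. This `w` solves the backward equation of a coupling of
two copies differing by one particle (`coupledGenerator_sub`), and backward equations of jump
generators preserve nonnegativity (`IsJumpGenerator.nonneg_of_hasDerivWithinAt`).

Write `r(n, k)` for the harmonic rate. At the site of the extra particle the coupling needs rates
`stay k`, `move k` with `stay k + move k = r(n, k)` and `stay k + move (k-1) = r(n+1, k)`. Solving
downwards from `move n = r(n+1, n+1)` makes `move k` a difference of tail sums of rates.
Nonnegativity follows from `r(n, k) ≤ r(n+1, k)` and `r(n+1, k+1) ≤ r(n, k)`; this is where `2s ≥ 1`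
enters. -/

noncomputable section

namespace InteractingParticles

/-! ### Positivity and uniqueness for finite linear ODEs -/

section FiniteLinearODE

variable {ι : Type*} [Fintype ι]

/-- The exponential of an operator with nonnegative entries preserves nonnegative vectors. -/
lemma exp_apply_nonneg_of_nonneg {B : (ι → ℝ) →L[ℝ] (ι → ℝ)} (hB : ∀ w, 0 ≤ w → 0 ≤ B w)
    {w : ι → ℝ} (hw : 0 ≤ w) : 0 ≤ NormedSpace.exp B w := by
  have hpow : ∀ n : ℕ, 0 ≤ (B ^ n) w := by
    intro n
    induction n with
    | zero => simpa using hw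
    | succ n ih => rw [pow_succ']; exact hB _ ih
  have h := NormedSpace.exp_series_hasSum_exp' (𝕂 := ℝ) B
  have h' := h.mapL (ContinuousLinearMap.apply ℝ (ι → ℝ) w)
  intro i
  refine HasSum.nonneg (fun n => ?_) (Pi.hasSum.1 h' i)
  have := hpow n i
  simp only [Pi.zero_apply] at this
  simp only [ContinuousLinearMap.apply_apply, _root_.smul_apply, Pi.smul_apply,
    smul_eq_mul]
  positivity

/-- The exponential of an operator with nonnegative off-diagonal entries preserves nonnegative
vectors. -/
lemma exp_smul_apply_nonneg {A : (ι → ℝ) →L[ℝ] (ι → ℝ)} {c : ℝ}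
    (hA : ∀ w, 0 ≤ w → 0 ≤ A w + c • w) {t : ℝ} (ht : 0 ≤ t) {w : ι → ℝ} (hw : 0 ≤ w) :
    0 ≤ NormedSpace.exp (t • A) w := by
  -- Shifting by the scalar `c` makes the operator entrywise nonnegative; the shift commutes with
  -- everything and only costs the positive factor `exp (-(t * c))`.
  have key : t • A = algebraMap ℝ ((ι → ℝ) →L[ℝ] (ι → ℝ)) (-(t * c)) + t • (A + c • 1) := by
    rw [Algebra.algebraMap_eq_smul_one]
    module
  let _ := NormedAlgebra.restrictScalars ℚ ℝ ((ι → ℝ) →L[ℝ] (ι → ℝ))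
  rw [key, NormedSpace.exp_add_of_commute (Algebra.commutes _ _), ← NormedSpace.algebraMap_exp_comm,
    Algebra.algebraMap_eq_smul_one, ← Real.exp_eq_exp_ℝ]
  have : 0 ≤ NormedSpace.exp (t • (A + c • 1)) w := by
    refine exp_apply_nonneg_of_nonneg (fun w hw => ?_) hw
    simpa using smul_nonneg ht (hA w hw)
  simpa using smul_nonneg (Real.exp_pos _).le this

lemma hasDerivAt_exp_smul_apply (A : (ι → ℝ) →L[ℝ] (ι → ℝ)) (w : ι → ℝ) (t : ℝ) :
    HasDerivAt (fun r : ℝ => NormedSpace.exp (r • A) w) (A (NormedSpace.exp (t • A) w)) t := by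
  simpa using (hasDerivAt_exp_smul_const' A t).clm_apply (hasDerivAt_const t w)

/-- A continuous solution of `u' = A u`, with right derivatives, is given by the exponential. -/
lemma eq_exp_smul_apply {A : (ι → ℝ) →L[ℝ] (ι → ℝ)} {u : ℝ → ι → ℝ}
    (hc : ContinuousOn u (Set.Ici 0))
    (hd : ∀ t, 0 ≤ t → HasDerivWithinAt u (A (u t)) (Set.Ici t) t) {t : ℝ} (ht : 0 ≤ t) :
    u t = NormedSpace.exp (t • A) (u 0) := by
  refine ODE_solution_unique (v := fun _ => A) (K := ‖A‖₊) (a := 0) (b := t)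
    (g := fun t => NormedSpace.exp (t • A) (u 0))
    (fun _ => A.lipschitz) (hc.mono Set.Icc_subset_Ici_self) (fun r hr => hd r hr.1) ?_ ?_ ?_
    (Set.right_mem_Icc.2 ht)
  · exact fun r _ => (hasDerivAt_exp_smul_apply A (u 0) r).continuousAt.continuousWithinAt
  · exact fun r _ => (hasDerivAt_exp_smul_apply A (u 0) r).hasDerivWithinAt
  · simp

end FiniteLinearODE

/-! ### Jump generators with a conserved quantity -/

section JumpGenerators

variable {X I : Type*}

/-- The functional `Λ` is the generator at `x` of a pure jump process with finitely many possible
jumps, none of which changes the conserved quantity `ℓ`. -/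
def IsJumpForm (ℓ : X → I) (x : X) (Λ : (X → ℝ) → ℝ) : Prop :=
  ∃ q : X →₀ ℝ, (∀ y, 0 ≤ q y) ∧ (∀ y ∈ q.support, ℓ y = ℓ x) ∧
    ∀ f, Λ f = q.sum fun y r => r * (f y - f x)

/-- The operator `L` is the generator of a pure jump process with finitely many possible jumps from
each state, which conserves the quantity `ℓ`. -/
def IsJumpGenerator (ℓ : X → I) (L : (X → ℝ) → X → ℝ) : Prop :=
  ∀ x, IsJumpForm ℓ x fun f => L f x

variable {ℓ : X → I} {x : X}

lemma IsJumpForm.zero : IsJumpForm ℓ x fun _ => 0 :=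
  ⟨0, by simp, by simp, by simp⟩

lemma IsJumpForm.add {Λ Λ' : (X → ℝ) → ℝ} (h : IsJumpForm ℓ x Λ) (h' : IsJumpForm ℓ x Λ') :
    IsJumpForm ℓ x fun f => Λ f + Λ' f := by
  classical
  obtain ⟨q, h0, hs, hf⟩ := h
  obtain ⟨q', h0', hs', hf'⟩ := h'
  refine ⟨q + q', fun y => add_nonneg (h0 y) (h0' y), fun y hy => ?_, fun f => ?_⟩
  · rcases Finset.mem_union.1 (Finsupp.support_add hy) with h | h
    exacts [hs y h, hs' y h]
  · beta_reduce
    rw [hf, hf', Finsupp.sum_add_index']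
    · simp
    · intros; ring

lemma IsJumpForm.sum {J : Type*} {Λ : J → (X → ℝ) → ℝ} {s : Finset J}
    (h : ∀ j ∈ s, IsJumpForm ℓ x (Λ j)) : IsJumpForm ℓ x fun f => ∑ j ∈ s, Λ j f := by
  classical
  induction s using Finset.induction_on with
  | empty => simpa using IsJumpForm.zero
  | insert a s ha ih =>
    simp only [Finset.sum_insert ha]
    exact (h a (by simp)).add (ih fun j hj => h j (by simp [hj]))

lemma IsJumpForm.single {c : ℝ} (hc : 0 ≤ c) {y : X} (hy : ℓ y = ℓ x) :
    IsJumpForm ℓ x fun f => c * (f y - f x) := by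
  classical
  refine ⟨Finsupp.single y c, fun z => ?_, fun z hz => ?_, fun f => ?_⟩
  · rw [Finsupp.single_apply]; split_ifs <;> simp [hc]
  · have := Finsupp.support_single_subset hz
    rw [Finset.mem_singleton.1 this, hy]
  · rw [Finsupp.sum_single_index]; simp

variable {L : (X → ℝ) → X → ℝ}

lemma IsJumpGenerator.map_one (hL : IsJumpGenerator ℓ L) : L 1 = 0 := by
  funext x
  obtain ⟨q, -, -, hf⟩ := hL x
  simp [hf, Finsupp.sum]

lemma IsJumpGenerator.map_sub (hL : IsJumpGenerator ℓ L) (f g : X → ℝ) :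
    L (f - g) = L f - L g := by
  funext x
  obtain ⟨q, -, -, hf⟩ := hL x
  simp only [hf, Finsupp.sum, Pi.sub_apply, ← Finset.sum_sub_distrib]
  exact Finset.sum_congr rfl fun y _ => by ring

/-- The restriction of a jump generator to a level set of the conserved quantity. -/
lemma IsJumpGenerator.exists_restrict (hL : IsJumpGenerator ℓ L) (n : I)
    [Fintype {y // ℓ y = n}] :
    ∃ (A : ({y // ℓ y = n} → ℝ) →L[ℝ] ({y // ℓ y = n} → ℝ)) (c : ℝ),
      (∀ f y, A (fun z => f z.1) y = L f y.1) ∧ ∀ w, 0 ≤ w → 0 ≤ A w + c • w := by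
  classical
  choose q h0 hs hf using hL
  -- Extension by zero; the value off the level set is immaterial, since no jump leaves it.
  let e : ({y // ℓ y = n} → ℝ) → X → ℝ := fun w z => if h : ℓ z = n then w ⟨z, h⟩ else 0
  let A : ({y // ℓ y = n} → ℝ) →ₗ[ℝ] ({y // ℓ y = n} → ℝ) :=
    { toFun := fun w y => (q y.1).sum fun z r => r * (e w z - w y)
      map_add' := fun w w' => by
        funext y
        simp only [Finsupp.sum, Pi.add_apply, ← Finset.sum_add_distrib, e]
        refine Finset.sum_congr rfl fun z _ => ?_
        split_ifs <;> ring
      map_smul' := fun a w => by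
        funext y
        simp only [Finsupp.sum, Pi.smul_apply, smul_eq_mul, Finset.mul_sum, e, RingHom.id_apply]
        refine Finset.sum_congr rfl fun z _ => ?_
        split_ifs <;> ring }
  -- The shift is the sum of all exit rates over the level set, which dominates each single exit
  -- rate and so compensates every diagonal entry.
  refine ⟨LinearMap.toContinuousLinearMap A, ∑ y : {y // ℓ y = n}, (q y.1).sum fun _ r => r,
    fun f y => ?_, fun w hw y => ?_⟩
  · refine Eq.trans ?_ (hf y.1 f).symm
    refine Finset.sum_congr rfl fun z hz => ?_
    simp [e, (hs _ z hz).trans y.2]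
  · have hrow : ∀ y : {y // ℓ y = n}, 0 ≤ (q y.1).sum fun _ r => r :=
      fun y => Finset.sum_nonneg fun z _ => h0 _ z
    have h1 : ((q y.1).sum fun _ r => r) ≤ ∑ y : {y // ℓ y = n}, (q y.1).sum fun _ r => r :=
      Finset.single_le_sum (f := fun y : {y // ℓ y = n} => (q y.1).sum fun _ r => r)
        (fun y _ => hrow y) (Finset.mem_univ y)
    have h2 : 0 ≤ (q y.1).sum fun z r => r * e w z := by
      refine Finset.sum_nonneg fun z _ => mul_nonneg (h0 _ z) ?_
      simp only [e]
      split_ifs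
      exacts [hw _, le_rfl]
    have h3 : A w y = ((q y.1).sum fun z r => r * e w z) - ((q y.1).sum fun _ r => r) * w y := by
      simp only [A, LinearMap.coe_mk, AddHom.coe_mk, Finsupp.sum, Finset.sum_mul, mul_sub,
        Finset.sum_sub_distrib]
    have h4 := mul_le_mul_of_nonneg_right h1 (hw y)
    simp only [Pi.zero_apply, LinearMap.coe_toContinuousLinearMap', Pi.add_apply, Pi.smul_apply,
      smul_eq_mul, h3]
    linarith

/-- Solutions of the backward equation `u' = L u` that are nonnegative at time `0` remain
nonnegative. -/
lemma IsJumpGenerator.nonneg_of_hasDerivWithinAt (hL : IsJumpGenerator ℓ L)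
    (hfin : ∀ n, Finite {y // ℓ y = n}) {u : ℝ → X → ℝ}
    (hc : ∀ x, ContinuousOn (fun t => u t x) (Set.Ici 0))
    (hd : ∀ t, 0 ≤ t → ∀ x, HasDerivWithinAt (fun r => u r x) (L (u t) x) (Set.Ici t) t)
    (h0 : 0 ≤ u 0) {t : ℝ} (ht : 0 ≤ t) : 0 ≤ u t := by
  intro x
  have := Fintype.ofFinite {y // ℓ y = ℓ x}
  obtain ⟨A, c, hA, hpos⟩ := hL.exists_restrict (ℓ x)
  have key := eq_exp_smul_apply (A := A) (u := fun t (y : {y // ℓ y = ℓ x}) => u t y)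
    (continuousOn_pi.2 fun y => hc y)
    (fun t ht => hasDerivWithinAt_pi.2 fun y => by simpa only [hA] using hd t ht y) ht
  have h1 := exp_smul_apply_nonneg hpos ht (w := fun y : {y // ℓ y = ℓ x} => u 0 y)
    (fun y => h0 y)
  rw [← key] at h1
  exact h1 ⟨x, rfl⟩

/-- Uniqueness for the backward equation `u' = L u`. -/
lemma IsJumpGenerator.eq_of_hasDerivWithinAt (hL : IsJumpGenerator ℓ L)
    (hfin : ∀ n, Finite {y // ℓ y = n}) {u v : ℝ → X → ℝ}
    (huc : ∀ x, ContinuousOn (fun t => u t x) (Set.Ici 0))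
    (hud : ∀ t, 0 ≤ t → ∀ x, HasDerivWithinAt (fun r => u r x) (L (u t) x) (Set.Ici t) t)
    (hvc : ∀ x, ContinuousOn (fun t => v t x) (Set.Ici 0))
    (hvd : ∀ t, 0 ≤ t → ∀ x, HasDerivWithinAt (fun r => v r x) (L (v t) x) (Set.Ici t) t)
    (h0 : u 0 = v 0) {t : ℝ} (ht : 0 ≤ t) : u t = v t := by
  refine le_antisymm ?_ ?_ <;> rw [← sub_nonneg]
  · refine hL.nonneg_of_hasDerivWithinAt hfin (u := fun t => v t - u t)
      (fun x => (hvc x).sub (huc x)) (fun t ht x => ?_) (by simp [h0]) ht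
    rw [hL.map_sub]
    exact (hvd t ht x).sub (hud t ht x)
  · refine hL.nonneg_of_hasDerivWithinAt hfin (u := fun t => u t - v t)
      (fun x => (huc x).sub (hvc x)) (fun t ht x => ?_) (by simp [h0]) ht
    rw [hL.map_sub]
    exact (hud t ht x).sub (hvd t ht x)

end JumpGenerators

/-! ### Markov semigroups on discrete spaces: backward equation, uniqueness, existence -/

section DiscreteSemigroups

variable {X : Type*} [MeasurableSpace X] [DiscreteMeasurableSpace X]

lemma integrable_of_abs_le {μ : Measure X} [IsFiniteMeasure μ] {f : X → ℝ} {C : ℝ}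
    (hf : ∀ x, |f x| ≤ C) : Integrable f μ :=
  Integrable.of_bound Measurable.of_discrete.aestronglyMeasurable C (ae_of_all _ hf)

lemma abs_integral_le {X : Type*} [MeasurableSpace X] {μ : Measure X} [IsProbabilityMeasure μ]
    {f : X → ℝ} {C : ℝ}
    (hf : ∀ x, |f x| ≤ C) : |∫ y, f y ∂μ| ≤ C := by
  simpa using norm_integral_le_of_norm_le_const (μ := μ) (f := f) (ae_of_all _ hf)

lemma abs_integral_sub_le {μ : Measure X} [IsProbabilityMeasure μ] {f : X → ℝ} {C : ℝ}
    (hf : ∀ x, |f x| ≤ C) (x : X) : |(∫ y, f y ∂μ) - f x| ≤ 2 * C * μ.real {x}ᶜ := by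
  have h1 : (∫ y, f y ∂μ) - f x = ∫ y, (f y - f x) ∂μ := by
    rw [integral_sub (integrable_of_abs_le (μ := μ) hf) (integrable_const _)]
    simp
  have hs : MeasurableSet ({x}ᶜ : Set X) := MeasurableSet.of_discrete
  have h2 : ∫ y, ({x}ᶜ : Set X).indicator (fun _ => 2 * C) y ∂μ = 2 * C * μ.real {x}ᶜ := by
    rw [integral_indicator_const _ hs, smul_eq_mul, mul_comm]
  rw [h1, ← h2, ← Real.norm_eq_abs]
  refine norm_integral_le_of_norm_le ((integrable_const (μ := μ) (2 * C)).indicator hs)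
    (ae_of_all _ fun y => ?_)
  by_cases hy : y = x
  · simp [hy]
  · rw [Set.indicator_of_mem (by simpa using hy), Real.norm_eq_abs]
    have := abs_sub (f y) (f x)
    linarith [hf x, hf y]

/-- A probability measure on a discrete space is determined by the integrals of bounded
functions. -/
lemma measure_eq_of_integral_eq {X : Type*} [MeasurableSpace X] {μ ν : Measure X}
    [IsProbabilityMeasure μ] [IsProbabilityMeasure ν]
    (h : ∀ f : X → ℝ, (∃ C : ℝ, ∀ x, |f x| ≤ C) → ∫ x, f x ∂μ = ∫ x, f x ∂ν) : μ = ν := by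
  refine Measure.ext fun s hs => ?_
  have := h (s.indicator 1) ⟨1, fun x => by by_cases hx : x ∈ s <;> simp [hx]⟩
  rw [integral_indicator_one hs, integral_indicator_one hs] at this
  exact (measureReal_eq_measureReal_iff).1 this

variable {S : ℝ≥0 → Kernel X X} {L : (X → ℝ) → X → ℝ}

lemma IsMarkovSemigroup.integral_add (hS : IsMarkovSemigroup S) (t h : ℝ≥0) {f : X → ℝ} {C : ℝ}
    (hf : ∀ x, |f x| ≤ C) (x : X) :
    ∫ y, f y ∂(S (t + h) x) = ∫ y, ∫ z, f z ∂(S h y) ∂(S t x) := by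
  have := hS.isMarkovKernel
  rw [hS.add, Kernel.integral_comp (integrable_of_abs_le hf)]

/-- The probability of having left `x` by time `h` tends to `0` as `h ↓ 0`. -/
lemma HasGenerator.tendsto_measureReal_compl (hS : IsMarkovSemigroup S)
    (hL : HasGenerator S L) (x : X) :
    Tendsto (fun h : ℝ≥0 => (S h x).real {x}ᶜ) (𝓝 0) (𝓝 0) := by
  have hs : MeasurableSet ({x}ᶜ : Set X) := MeasurableSet.of_discrete
  have h0 : (S 0 x).real {x}ᶜ = 0 := by
    rw [hS.zero, Kernel.id_apply, measureReal_def, Measure.dirac_apply' _ hs]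
    simp
  have hc : ContinuousAt (fun h : ℝ≥0 => (S h x).real {x}ᶜ) 0 := by
    rw [continuousAt_iff_punctured_nhds, h0]
    have hset : ({0}ᶜ : Set ℝ≥0) = Set.Ioi 0 := by ext; simp [pos_iff_ne_zero]
    rw [hset]
    -- This indicator vanishes at `x`, so the probability of having left, divided by `t`, has a
    -- finite limit; multiplying by `t` gives limit zero.
    have h1 := hL (({x}ᶜ : Set X).indicator 1) Measurable.of_discrete
      ⟨1, fun y => by by_cases hy : y = x <;> simp [hy]⟩ x
    have h2 : Tendsto (fun t : ℝ≥0 => (t : ℝ)) (𝓝[>] 0) (𝓝 0) :=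
      (NNReal.continuous_coe.tendsto' 0 0 rfl).mono_left nhdsWithin_le_nhds
    have h3 := h1.mul h2
    rw [mul_zero] at h3
    refine h3.congr' ?_
    filter_upwards [self_mem_nhdsWithin] with t ht
    have ht' : (t : ℝ) ≠ 0 := by simpa using (Set.mem_Ioi.1 ht).ne'
    rw [integral_indicator_one hs, div_mul_cancel₀ _ ht']
    simp
  simpa [ContinuousAt, h0] using hc

lemma HasGenerator.continuous_integral (hS : IsMarkovSemigroup S)
    (hL : HasGenerator S L) {f : X → ℝ} {C : ℝ} (hf : ∀ x, |f x| ≤ C) (x : X) :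
    Continuous fun t : ℝ≥0 => ∫ y, f y ∂(S t x) := by
  have := hS.isMarkovKernel
  -- Writing `S(h + t) f = S(h) (S(t) f)` gives a bound that does not depend on `t`, so it yields
  -- left continuity as well as right continuity.
  have key : ∀ t h : ℝ≥0, dist (∫ y, f y ∂(S (h + t) x)) (∫ y, f y ∂(S t x)) ≤
      2 * C * (S h x).real {x}ᶜ := by
    intro t h
    rw [hS.integral_add h t hf, Real.dist_eq]
    exact abs_integral_sub_le (fun y => abs_integral_le hf) x
  refine continuous_iff_continuousAt.2 fun t => ?_
  rw [ContinuousAt, tendsto_iff_dist_tendsto_zero]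
  have h1 : Tendsto (fun r : ℝ≥0 => nndist r t) (𝓝 t) (𝓝 0) :=
    (continuous_id.nndist continuous_const).tendsto' _ _ (by simp)
  have h2 := ((hL.tendsto_measureReal_compl hS x).comp h1).const_mul (2 * C)
  rw [mul_zero] at h2
  refine squeeze_zero (fun _ => dist_nonneg) (fun r => ?_) h2
  simp only [Function.comp]
  rcases le_total r t with h | h
  · have := key r (t - r)
    rw [tsub_add_cancel_of_le h] at this
    rwa [NNReal.nndist_eq, tsub_eq_zero_of_le h, max_eq_right zero_le, dist_comm]
  · have := key t (r - t)
    rw [tsub_add_cancel_of_le h] at this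
    rwa [NNReal.nndist_eq, tsub_eq_zero_of_le h, max_eq_left zero_le]

/-- The backward equation: `t ↦ S(t) f` has right derivative `L S(t) f`. -/
lemma HasGenerator.hasDerivWithinAt_integral (hS : IsMarkovSemigroup S)
    (hL : HasGenerator S L) {f : X → ℝ} {C : ℝ} (hf : ∀ x, |f x| ≤ C) {t : ℝ} (ht : 0 ≤ t)
    (x : X) :
    HasDerivWithinAt (fun r : ℝ => ∫ y, f y ∂(S r.toNNReal x))
      (L (fun z => ∫ y, f y ∂(S t.toNNReal z)) x) (Set.Ici t) t := by
  have := hS.isMarkovKernel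
  rw [← hasDerivWithinAt_Ioi_iff_Ici, hasDerivWithinAt_iff_tendsto_slope' (by simp)]
  have h1 := hL (fun z => ∫ y, f y ∂(S t.toNNReal z)) Measurable.of_discrete
    ⟨C, fun z => abs_integral_le hf⟩ x
  have h2 : Tendsto (fun r : ℝ => (r - t).toNNReal) (𝓝[>] t) (𝓝[>] 0) := by
    refine tendsto_nhdsWithin_iff.2 ⟨?_, ?_⟩
    · exact (Continuous.tendsto' (by fun_prop) _ _ (by simp)).mono_left nhdsWithin_le_nhds
    · filter_upwards [self_mem_nhdsWithin] with r hr
      simpa using hr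
  refine (h1.comp h2).congr' ?_
  filter_upwards [self_mem_nhdsWithin] with r hr
  have hr' : 0 ≤ r - t := sub_nonneg.2 (le_of_lt hr)
  have h3 : r.toNNReal = (r - t).toNNReal + t.toNNReal := by
    rw [← Real.toNNReal_add hr' ht, sub_add_cancel]
  rw [Function.comp, slope_def_field, h3, hS.integral_add _ _ hf, Real.coe_toNNReal _ hr']

/-- If the conserved quantity of a jump generator has finite level sets, then there is at most one
Markov semigroup with this generator. -/
lemma IsMarkovSemigroup.eq_of_hasGenerator {I : Type*} {ℓ : X → I} (hL : IsJumpGenerator ℓ L)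
    (hfin : ∀ n, Finite {y // ℓ y = n}) {S S' : ℝ≥0 → Kernel X X} (hS : IsMarkovSemigroup S)
    (hSL : HasGenerator S L) (hS' : IsMarkovSemigroup S') (hSL' : HasGenerator S' L) : S = S' := by
  have := hS.isMarkovKernel
  have := hS'.isMarkovKernel
  funext t
  refine Kernel.ext fun x => measure_eq_of_integral_eq fun f ⟨C, hf⟩ => ?_
  have key := hL.eq_of_hasDerivWithinAt hfin
    (u := fun r x => ∫ y, f y ∂(S r.toNNReal x)) (v := fun r x => ∫ y, f y ∂(S' r.toNNReal x))
    (fun x => ((hSL.continuous_integral hS hf x).comp continuous_real_toNNReal).continuousOn)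
    (fun t ht x => hSL.hasDerivWithinAt_integral hS hf ht x)
    (fun x => ((hSL'.continuous_integral hS' hf x).comp continuous_real_toNNReal).continuousOn)
    (fun t ht x => hSL'.hasDerivWithinAt_integral hS' hf ht x)
    (by simp [hS.zero, hS'.zero]) t.2
  simpa using congrFun key x

/-- A jump generator whose conserved quantity has finite level sets generates a Markov
semigroup. -/
lemma IsJumpGenerator.exists_isMarkovSemigroup [Countable X] {I : Type*} {ℓ : X → I}
    (hL : IsJumpGenerator ℓ L) (hfin : ∀ n, Finite {y // ℓ y = n}) :
    ∃ S : ℝ≥0 → Kernel X X, IsMarkovSemigroup S ∧ HasGenerator S L := by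
  classical
  have : ∀ n, Fintype {y // ℓ y = n} := fun n => Fintype.ofFinite _
  choose A c hA hpos using fun n => hL.exists_restrict n
  let T : ℝ≥0 → (X → ℝ) → X → ℝ := fun t f x =>
    NormedSpace.exp ((t : ℝ) • A (ℓ x)) (fun y => f y) ⟨x, rfl⟩
  have hT : ∀ (t : ℝ≥0) f n (y : {y // ℓ y = n}),
      NormedSpace.exp ((t : ℝ) • A n) (fun y => f y) y = T t f y := by
    rintro t f n ⟨y, rfl⟩
    rfl
  have hTone : ∀ t x, T t (fun _ => 1) x = 1 := by
    intro t x
    -- The constant `1` is a stationary solution because `L 1 = 0`.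
    have := eq_exp_smul_apply (A := A (ℓ x)) (u := fun _ _ => 1) continuousOn_const
      (fun t ht => by
        have : A (ℓ x) (fun _ => 1) = 0 := by
          funext y
          rw [hA (ℓ x) (fun _ => 1) y]
          exact congrFun hL.map_one y
        rw [this]
        exact hasDerivWithinAt_const _ _ _) t.2
    exact (congrFun this ⟨x, rfl⟩).symm
  have hTadd : ∀ t u f x, T (t + u) f x = T t (T u f) x := by
    intro t u f x
    have hcomm : Commute ((t : ℝ) • A (ℓ x)) ((u : ℝ) • A (ℓ x)) :=
      ((Commute.refl _).smul_left _).smul_right _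
    let _ := NormedAlgebra.restrictScalars ℚ ℝ
      (({y // ℓ y = ℓ x} → ℝ) →L[ℝ] ({y // ℓ y = ℓ x} → ℝ))
    simp only [T, NNReal.coe_add, add_smul, NormedSpace.exp_add_of_commute hcomm]
    rw [mul_apply_eq_comp]
    exact congrArg (fun w => NormedSpace.exp ((t : ℝ) • A (ℓ x)) w ⟨x, rfl⟩) (funext (hT u f _))
  let κ : ℝ≥0 → Kernel X X := fun t => Kernel.ofFunOfCountable fun x =>
    ∑ y : {y // ℓ y = ℓ x}, ENNReal.ofReal
      (NormedSpace.exp ((t : ℝ) • A (ℓ x)) (Pi.single y 1) ⟨x, rfl⟩) • Measure.dirac y.1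
  have hint : ∀ t f x, ∫ y, f y ∂(κ t x) = T t f x := by
    intro t f x
    have hf : (fun y : {y // ℓ y = ℓ x} => f y.1) = ∑ y, f y.1 • Pi.single y 1 :=
      pi_eq_sum_univ' _
    simp only [κ, Kernel.ofFunOfCountable, Kernel.coe_mk, T]
    rw [integral_finsetSum_measure, hf, map_sum, Finset.sum_apply]
    · refine Finset.sum_congr rfl fun y _ => ?_
      have h0 : 0 ≤ NormedSpace.exp ((t : ℝ) • A (ℓ x)) (Pi.single y 1) ⟨x, rfl⟩ :=
        exp_smul_apply_nonneg (hpos _) t.2 (Pi.single_nonneg.2 zero_le_one) _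
      rw [integral_smul_measure, integral_dirac, ENNReal.toReal_ofReal h0, map_smul, Pi.smul_apply,
        smul_eq_mul, smul_eq_mul, mul_comm]
    · intro y _
      exact (integrable_dirac (by simp)).smul_measure ENNReal.ofReal_ne_top
  have hmarkov : ∀ t, IsMarkovKernel (κ t) := fun t => ⟨fun x => ⟨by
    have h1 := hint t (fun _ => 1) x
    rw [hTone, integral_const, smul_eq_mul, mul_one] at h1
    rwa [measureReal_def, ENNReal.toReal_eq_one_iff] at h1⟩⟩
  refine ⟨κ, ⟨hmarkov, ?_, ?_⟩, ?_⟩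
  · refine Kernel.ext fun x => measure_eq_of_integral_eq fun f _ => ?_
    rw [hint]
    simp [T, Kernel.id_apply]
  · intro t u
    refine Kernel.ext fun x => measure_eq_of_integral_eq fun f ⟨C, hf⟩ => ?_
    rw [Kernel.integral_comp (integrable_of_abs_le hf), hint, hint, hTadd]
    exact congrArg (fun w => T t w x) (funext fun y => (hint u f y).symm)
  · intro f _ _ x
    have h1 := hasDerivAt_pi.1 (hasDerivAt_exp_smul_apply (A (ℓ x)) (fun y => f y) 0) ⟨x, rfl⟩
    rw [zero_smul, NormedSpace.exp_zero, one_apply_eq_self, hA,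
      hasDerivAt_iff_tendsto_slope] at h1
    have h2 : Tendsto (fun t : ℝ≥0 => (t : ℝ)) (𝓝[>] 0) (𝓝[≠] 0) := by
      refine tendsto_nhdsWithin_iff.2
        ⟨(NNReal.continuous_coe.tendsto' 0 0 rfl).mono_left nhdsWithin_le_nhds, ?_⟩
      filter_upwards [self_mem_nhdsWithin] with t ht
      simpa using (Set.mem_Ioi.1 ht).ne'
    refine (h1.comp h2).congr fun t => ?_
    rw [hint, Function.comp, slope_def_field]
    simp [T]

end DiscreteSemigroups

/-! ### Monotonicity of the harmonic rates and the coupling rates -/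

section HarmonicRates

variable {s : ℝ} {n k : ℕ}

lemma harmonicRate_nonneg (hs : 1 / 2 ≤ s) (hk : k ≤ n) : 0 ≤ harmonicRate s n k := by
  have hk' : (k : ℝ) ≤ n := by exact_mod_cast hk
  have h1 : 0 < Real.Gamma ((n : ℝ) + 1) := Real.Gamma_pos_of_pos (by positivity)
  have h2 : 0 < Real.Gamma ((n : ℝ) - k + 2 * s) := Real.Gamma_pos_of_pos (by linarith)
  have h3 : 0 < Real.Gamma ((n : ℝ) - k + 1) := Real.Gamma_pos_of_pos (by linarith)
  have h4 : 0 < Real.Gamma ((n : ℝ) + 2 * s) :=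
    Real.Gamma_pos_of_pos (by have : (0 : ℝ) ≤ n := by positivity
                              linarith)
  unfold harmonicRate
  positivity

lemma harmonicRate_succ_left (hs : 1 / 2 ≤ s) (hk : k ≤ n) :
    harmonicRate s (n + 1) k =
      harmonicRate s n k * (((n + 1) * (n - k + 2 * s)) / ((n - k + 1) * (n + 2 * s))) := by
  have hk' : (k : ℝ) ≤ n := by exact_mod_cast hk
  have hn : (0 : ℝ) ≤ n := by positivity
  have e1 : Real.Gamma ((n : ℝ) + 1 + 1) = (n + 1) * Real.Gamma ((n : ℝ) + 1) :=
    Real.Gamma_add_one (by positivity)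
  have e2 : Real.Gamma ((n : ℝ) + 1 - k + 2 * s) =
      (n - k + 2 * s) * Real.Gamma ((n : ℝ) - k + 2 * s) := by
    rw [← Real.Gamma_add_one (by linarith)]; ring_nf
  have e3 : Real.Gamma ((n : ℝ) + 1 - k + 1) = (n - k + 1) * Real.Gamma ((n : ℝ) - k + 1) := by
    rw [← Real.Gamma_add_one (by linarith)]; ring_nf
  have e4 : Real.Gamma ((n : ℝ) + 1 + 2 * s) = (n + 2 * s) * Real.Gamma ((n : ℝ) + 2 * s) := by
    rw [← Real.Gamma_add_one (by linarith)]; ring_nf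
  unfold harmonicRate
  push_cast
  rw [e1, e2, e3, e4, div_mul_div_comm]
  congr 1 <;> ring

lemma harmonicRate_succ_succ (hs : 1 / 2 ≤ s) (hk0 : 1 ≤ k) :
    harmonicRate s (n + 1) (k + 1) =
      harmonicRate s n k * ((k * (n + 1)) / ((k + 1) * (n + 2 * s))) := by
  have hn : (0 : ℝ) ≤ n := by positivity
  have hk' : (k : ℝ) ≠ 0 := by positivity
  have e1 : Real.Gamma ((n : ℝ) + 1 + 1) = (n + 1) * Real.Gamma ((n : ℝ) + 1) :=
    Real.Gamma_add_one (by positivity)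
  have e4 : Real.Gamma ((n : ℝ) + 1 + 2 * s) = (n + 2 * s) * Real.Gamma ((n : ℝ) + 2 * s) := by
    rw [← Real.Gamma_add_one (by linarith)]; ring_nf
  unfold harmonicRate
  push_cast
  rw [e1, e4, div_mul_div_comm, add_sub_add_right_eq_sub, ← mul_div_mul_left _ _ hk']
  congr 1 <;> ring

/-- The rate at which `k` particles jump is nondecreasing in the occupation number. -/
lemma harmonicRate_le_succ_left (hs : 1 / 2 ≤ s) (hk : k ≤ n) :
    harmonicRate s n k ≤ harmonicRate s (n + 1) k := by
  have hk' : (k : ℝ) ≤ n := by exact_mod_cast hk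
  have hn : (0 : ℝ) ≤ n := by positivity
  have hk0 : (0 : ℝ) ≤ k := by positivity
  rw [harmonicRate_succ_left hs hk]
  refine le_mul_of_one_le_right (harmonicRate_nonneg hs hk) ?_
  rw [one_le_div (mul_pos (by linarith) (by linarith))]
  -- Numerator minus denominator is exactly `(2 * s - 1) * k`.
  nlinarith [mul_nonneg (show (0 : ℝ) ≤ 2 * s - 1 by linarith) hk0]

lemma harmonicRate_succ_succ_le (hs : 1 / 2 ≤ s) (hk0 : 1 ≤ k) (hk : k ≤ n) :
    harmonicRate s (n + 1) (k + 1) ≤ harmonicRate s n k := by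
  have hn : (0 : ℝ) ≤ n := by positivity
  have hk' : (0 : ℝ) ≤ k := by positivity
  rw [harmonicRate_succ_succ hs hk0]
  refine mul_le_of_le_one_right (harmonicRate_nonneg hs hk) ?_
  rw [div_le_one (mul_pos (by linarith) (by linarith))]
  exact mul_le_mul (by linarith) (by linarith) (by linarith) (by linarith)

/-- In the coupling of two copies of the model whose configurations differ by one particle, located
at a site occupied by `n` other particles, the rate at which this particle jumps together with `k`
of the others. -/
def couplingMoveRate (s : ℝ) (n k : ℕ) : ℝ :=
  ∑ j ∈ Finset.Ico (k + 1) (n + 2), harmonicRate s (n + 1) j -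
    ∑ j ∈ Finset.Ico (k + 1) (n + 1), harmonicRate s n j

/-- In the coupling of two copies of the model whose configurations differ by one particle, located
at a site occupied by `n` other particles, the rate at which `k` of the others jump without it. -/
def couplingStayRate (s : ℝ) (n k : ℕ) : ℝ :=
  harmonicRate s n k - couplingMoveRate s n k

lemma couplingMoveRate_nonneg (hs : 1 / 2 ≤ s) (hk : k ≤ n) : 0 ≤ couplingMoveRate s n k := by
  unfold couplingMoveRate
  rw [Finset.sum_Ico_succ_top (by omega)]
  have h1 : ∑ j ∈ Finset.Ico (k + 1) (n + 1), harmonicRate s n j ≤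
      ∑ j ∈ Finset.Ico (k + 1) (n + 1), harmonicRate s (n + 1) j :=
    Finset.sum_le_sum fun j hj => harmonicRate_le_succ_left hs (by
      have := (Finset.mem_Ico.1 hj).2; omega)
  have h2 : 0 ≤ harmonicRate s (n + 1) (n + 1) := harmonicRate_nonneg hs le_rfl
  linarith

lemma couplingMoveRate_self : couplingMoveRate s n n = harmonicRate s (n + 1) (n + 1) := by
  simp [couplingMoveRate]

lemma couplingMoveRate_eq_add (hk : k < n) : couplingMoveRate s n k =
    couplingMoveRate s n (k + 1) + harmonicRate s (n + 1) (k + 1) - harmonicRate s n (k + 1) := by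
  unfold couplingMoveRate
  rw [Finset.sum_eq_sum_Ico_succ_bot (show k + 1 < n + 2 by omega),
    Finset.sum_eq_sum_Ico_succ_bot (show k + 1 < n + 1 by omega)]
  ring

/-- This rate is the rate of jumps of at least `k` particles out of `n`, minus that of at least `k +
1` out of `n + 1`; shifting the index allows a termwise comparison. -/
lemma couplingStayRate_nonneg (hs : 1 / 2 ≤ s) (hk0 : 1 ≤ k) (hk : k ≤ n) :
    0 ≤ couplingStayRate s n k := by
  have h1 : couplingStayRate s n k = ∑ j ∈ Finset.Ico k (n + 1), harmonicRate s n j -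
      ∑ j ∈ Finset.Ico (k + 1) (n + 2), harmonicRate s (n + 1) j := by
    rw [Finset.sum_eq_sum_Ico_succ_bot (show k < n + 1 by omega)]
    unfold couplingStayRate couplingMoveRate
    ring
  have h2 : ∑ j ∈ Finset.Ico (k + 1) (n + 2), harmonicRate s (n + 1) j =
      ∑ j ∈ Finset.Ico k (n + 1), harmonicRate s (n + 1) (j + 1) :=
    (Finset.sum_Ico_add' _ k (n + 1) 1).symm
  rw [h1, h2, sub_nonneg]
  refine Finset.sum_le_sum fun j hj => ?_
  have := Finset.mem_Ico.1 hj
  exact harmonicRate_succ_succ_le hs (by omega) (by omega)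

/-- The marginals of the coupled jumps are the jumps of the two copies. -/
lemma sum_couplingRate (s : ℝ) (n : ℕ) (α β : ℕ → ℝ) (hβ : β 0 = 0) :
    ∑ k ∈ Finset.Icc 1 n, couplingStayRate s n k * (α k - β k) +
        ∑ k ∈ Finset.range (n + 1), couplingMoveRate s n k * (α (k + 1) - β k) =
      ∑ k ∈ Finset.Icc 1 (n + 1), harmonicRate s (n + 1) k * α k -
        ∑ k ∈ Finset.Icc 1 n, harmonicRate s n k * β k := by
  have hIcc : ∀ (m : ℕ) (h : ℕ → ℝ),
      ∑ k ∈ Finset.Icc 1 m, h k = ∑ k ∈ Finset.range m, h (k + 1) := by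
    intro m h
    rw [Finset.range_eq_Ico, Finset.sum_Ico_add' h 0 m 1]
    rfl
  simp only [hIcc, mul_sub, Finset.sum_sub_distrib]
  -- The boundary terms are split off: at `k = n` the whole upper pile jumps, and at `k = 0` the
  -- extra particle jumps alone, so the lower copy contributes `β 0 = 0`.
  rw [Finset.sum_range_succ (fun k => couplingMoveRate s n k * α (k + 1)),
    Finset.sum_range_succ' (fun k => couplingMoveRate s n k * β k),
    Finset.sum_range_succ (fun k => harmonicRate s (n + 1) (k + 1) * α (k + 1)),
    couplingMoveRate_self, hβ]
  have h1 : ∑ k ∈ Finset.range n, harmonicRate s (n + 1) (k + 1) * α (k + 1) =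
      ∑ k ∈ Finset.range n, couplingStayRate s n (k + 1) * α (k + 1) +
        ∑ k ∈ Finset.range n, couplingMoveRate s n k * α (k + 1) := by
    rw [← Finset.sum_add_distrib]
    refine Finset.sum_congr rfl fun k hk => ?_
    rw [couplingMoveRate_eq_add (Finset.mem_range.1 hk), couplingStayRate]
    ring
  have h2 : ∑ k ∈ Finset.range n, harmonicRate s n (k + 1) * β (k + 1) =
      ∑ k ∈ Finset.range n, couplingStayRate s n (k + 1) * β (k + 1) +
        ∑ k ∈ Finset.range n, couplingMoveRate s n (k + 1) * β (k + 1) := by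
    rw [← Finset.sum_add_distrib]
    refine Finset.sum_congr rfl fun k hk => ?_
    rw [couplingStayRate]
    ring
  rw [h1, h2]
  ring

end HarmonicRates

/-! ### The coupled process and attractiveness -/

section HarmonicModel

variable {N : ℕ} {s : ℝ}

lemma single_le_of_le {η : Config N} {x : ZMod N} {k : ℕ} (hk : k ≤ η x) : Pi.single x k ≤ η := by
  intro i
  by_cases hi : i = x
  · subst hi
    simpa using hk
  · simp [hi]

lemma jump_zero (η : Config N) (x y : ZMod N) : jump η x y 0 = η := by
  simp [jump]

lemma jump_add_single {η : Config N} {x : ZMod N} {k : ℕ} (hk : k ≤ η x) (y z : ZMod N) :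
    jump (η + Pi.single z 1) x y k = jump η x y k + Pi.single z 1 := by
  funext i
  by_cases hi : i = x
  · subst hi
    simp only [jump, Pi.add_apply, Pi.sub_apply, Pi.single_eq_same]
    omega
  · simp only [jump, Pi.add_apply, Pi.sub_apply, Pi.single_eq_of_ne hi]
    omega

lemma jump_succ_add_single (η : Config N) (x y : ZMod N) (k : ℕ) :
    jump (η + Pi.single x 1) x y (k + 1) = jump η x y k + Pi.single y 1 := by
  simp only [jump, Pi.single_add, add_assoc]
  rw [add_tsub_add_eq_tsub_right]

/-- The part of the coupled generator that moves particles from the site `x` to the site `y`. A pair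
`(η, z)` stands for the ordered pair of configurations `η ≤ η + δ_z`. -/
def coupledNabla (s : ℝ) (x y : ZMod N) (w : Config N × ZMod N → ℝ) (p : Config N × ZMod N) : ℝ :=
  if x = p.2 then
    ∑ k ∈ Finset.Icc 1 (p.1 x), couplingStayRate s (p.1 x) k * (w (jump p.1 x y k, p.2) - w p) +
      ∑ k ∈ Finset.range (p.1 x + 1), couplingMoveRate s (p.1 x) k * (w (jump p.1 x y k, y) - w p)
  else
    ∑ k ∈ Finset.Icc 1 (p.1 x), harmonicRate s (p.1 x) k * (w (jump p.1 x y k, p.2) - w p)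

/-- At the discrepancy site this is the marginal identity `sum_couplingRate`; at any other departure
site both copies have the same occupation number and jump together. -/
lemma coupledNabla_sub (s : ℝ) (x y : ZMod N) (u : Config N → ℝ) (p : Config N × ZMod N) :
    coupledNabla s x y (fun p => u (p.1 + Pi.single p.2 1) - u p.1) p =
      harmonicNabla s x y u (p.1 + Pi.single p.2 1) - harmonicNabla s x y u p.1 := by
  obtain ⟨η, z⟩ := p
  unfold coupledNabla harmonicNabla
  simp only
  split_ifs with hx
  · subst hx
    have h1 := sum_couplingRate s (η x)
      (fun k => u (jump (η + Pi.single x 1) x y k) - u (η + Pi.single x 1))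
      (fun k => u (jump η x y k) - u η) (by simp [jump_zero])
    have h2 : (η + Pi.single x 1 : Config N) x = η x + 1 := by simp
    rw [h2, ← h1]
    congr 1
    · refine Finset.sum_congr rfl fun k hk => ?_
      rw [jump_add_single (Finset.mem_Icc.1 hk).2]
      ring
    · refine Finset.sum_congr rfl fun k _ => ?_
      rw [jump_succ_add_single]
      ring
  · have h2 : (η + Pi.single z 1 : Config N) x = η x := by simp [hx]
    rw [h2, ← Finset.sum_sub_distrib]
    refine Finset.sum_congr rfl fun k hk => ?_
    rw [jump_add_single (Finset.mem_Icc.1 hk).2]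
    ring

variable [NeZero N]

/-- The number of particles of a configuration. -/
def particleNumber (η : Config N) : ℕ := ∑ i, η i

lemma particleNumber_jump {η : Config N} {x : ZMod N} {k : ℕ} (hk : k ≤ η x) (y : ZMod N) :
    particleNumber (jump η x y k) = particleNumber η := by
  have hle : Pi.single x k ≤ η := single_le_of_le hk
  have h1 : particleNumber (jump η x y k) + k = particleNumber η + k := by
    have h2 : jump η x y k + Pi.single x k = η + Pi.single y k := by
      rw [jump, add_right_comm, tsub_add_cancel_of_le hle]
    have h3 := congrArg (fun ξ : Config N => ∑ i, ξ i) h2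
    simpa [Finset.sum_add_distrib, particleNumber] using h3
  omega

lemma finite_particleNumber_eq (n : ℕ) : Finite {η : Config N // particleNumber η = n} := by
  refine Set.Finite.subset (Set.finite_Iic (fun _ => n : Config N)) fun η hη i => ?_
  rw [← show particleNumber η = n from hη]
  exact Finset.single_le_sum (f := η) (fun _ _ => Nat.zero_le _) (Finset.mem_univ i)

lemma isJumpGenerator_harmonicGenerator (hs : 1 / 2 ≤ s) :
    IsJumpGenerator (particleNumber (N := N)) (harmonicGenerator N s) := by
  have key : ∀ (η : Config N) (x y : ZMod N),
      IsJumpForm particleNumber η fun f => harmonicNabla s x y f η := by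
    intro η x y
    refine IsJumpForm.sum fun k hk => ?_
    have hk' := (Finset.mem_Icc.1 hk).2
    exact IsJumpForm.single (harmonicRate_nonneg hs hk') (particleNumber_jump hk' y)
  exact fun η => IsJumpForm.sum fun x _ => (key η _ _).add (key η _ _)

/-- The generator of the coupling of two copies of the harmonic model whose configurations differ by
one particle. -/
def coupledGenerator (N : ℕ) [NeZero N] (s : ℝ) (w : Config N × ZMod N → ℝ)
    (p : Config N × ZMod N) : ℝ :=
  ∑ x : ZMod N, (coupledNabla s x (x + 1) w p + coupledNabla s (x + 1) x w p)

lemma isJumpGenerator_coupledGenerator (hs : 1 / 2 ≤ s) :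
    IsJumpGenerator (fun p : Config N × ZMod N => particleNumber p.1) (coupledGenerator N s) := by
  have key : ∀ (p : Config N × ZMod N) (x y : ZMod N),
      IsJumpForm (fun p : Config N × ZMod N => particleNumber p.1) p
        fun w => coupledNabla s x y w p := by
    intro p x y
    unfold coupledNabla
    split_ifs
    · refine (IsJumpForm.sum fun k hk => ?_).add (IsJumpForm.sum fun k hk => ?_)
      · have hk' := Finset.mem_Icc.1 hk
        exact IsJumpForm.single (couplingStayRate_nonneg hs hk'.1 hk'.2)
          (particleNumber_jump hk'.2 y)
      · have hk' := Finset.mem_range_succ_iff.1 hk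
        exact IsJumpForm.single (couplingMoveRate_nonneg hs hk') (particleNumber_jump hk' y)
    · refine IsJumpForm.sum fun k hk => ?_
      have hk' := (Finset.mem_Icc.1 hk).2
      exact IsJumpForm.single (harmonicRate_nonneg hs hk') (particleNumber_jump hk' y)
  exact fun p => IsJumpForm.sum fun x _ => (key p _ _).add (key p _ _)

lemma coupledGenerator_sub (s : ℝ) (u : Config N → ℝ) (p : Config N × ZMod N) :
    coupledGenerator N s (fun p => u (p.1 + Pi.single p.2 1) - u p.1) p =
      harmonicGenerator N s u (p.1 + Pi.single p.2 1) - harmonicGenerator N s u p.1 := by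
  simp only [coupledGenerator, harmonicGenerator, coupledNabla_sub, ← Finset.sum_sub_distrib]
  exact Finset.sum_congr rfl fun x _ => by ring

/-- Ordered configurations are joined by adding particles one at a time, so a single discrepancy
suffices for the coupling. -/
lemma monotone_of_le_add_single {f : Config N → ℝ} (hf : ∀ η z, f η ≤ f (η + Pi.single z 1)) :
    Monotone f := by
  have key : ∀ (n : ℕ) (η d : Config N), particleNumber d = n → f η ≤ f (η + d) := by
    intro n
    induction n with
    | zero =>
      intro η d hd
      have : d = 0 := by
        funext i
        simpa using (Finset.sum_eq_zero_iff.1 hd) i (Finset.mem_univ i)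
      simp [this]
    | succ n ih =>
      intro η d hd
      obtain ⟨z, -, hz⟩ : ∃ z ∈ Finset.univ, d z ≠ 0 :=
        Finset.exists_ne_zero_of_sum_ne_zero (show particleNumber d ≠ 0 by omega)
      have hdz : d - Pi.single z 1 + Pi.single z 1 = d :=
        tsub_add_cancel_of_le (single_le_of_le (Nat.one_le_iff_ne_zero.2 hz))
      have hsum : particleNumber (d - Pi.single z 1) = n := by
        rw [← hdz] at hd
        simp only [particleNumber, Pi.add_apply, Finset.sum_add_distrib] at hd
        simp only [Finset.sum_pi_single', Finset.mem_univ, if_true] at hd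
        simp only [particleNumber]
        omega
      calc f η ≤ f (η + (d - Pi.single z 1)) := ih _ _ hsum
        _ ≤ f (η + (d - Pi.single z 1) + Pi.single z 1) := hf _ _
        _ = f (η + d) := by rw [add_assoc, hdz]
  intro η ξ h
  simpa [add_tsub_cancel_of_le h] using key _ η (ξ - η) rfl

/-- The semigroup of the harmonic model preserves monotone functions. -/
lemma monotone_integral (hs : 1 / 2 ≤ s) {S : ℝ≥0 → Kernel (Config N) (Config N)}
    (hS : IsMarkovSemigroup S) (hL : HasGenerator S (harmonicGenerator N s))
    {f : Config N → ℝ} {C : ℝ} (hC : ∀ η, |f η| ≤ C) (hf : Monotone f) (t : ℝ≥0) :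
    Monotone fun η => ∫ ξ, f ξ ∂(S t η) := by
  refine monotone_of_le_add_single fun η z => ?_
  have hc : ∀ η, ContinuousOn (fun r : ℝ => ∫ ξ, f ξ ∂(S r.toNNReal η)) (Set.Ici 0) :=
    fun η => ((hL.continuous_integral hS hC η).comp continuous_real_toNNReal).continuousOn
  have hfin : ∀ n, Finite {p : Config N × ZMod N // particleNumber p.1 = n} := by
    intro n
    have : {η : Config N | particleNumber η = n}.Finite := finite_particleNumber_eq n
    refine Set.Finite.subset (this.prod (Set.finite_univ (α := ZMod N))) fun p hp => ?_
    exact ⟨hp, trivial⟩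
  -- The increment of `S(t) f` is nonnegative at time `0` because `f` is monotone, and positivity of
  -- the coupled evolution propagates this.
  have key := (isJumpGenerator_coupledGenerator (N := N) hs).nonneg_of_hasDerivWithinAt hfin
    (u := fun r p => (∫ ξ, f ξ ∂(S r.toNNReal (p.1 + Pi.single p.2 1))) -
      ∫ ξ, f ξ ∂(S r.toNNReal p.1))
    (fun p => (hc _).sub (hc _))
    (fun r hr p => by
      rw [coupledGenerator_sub s (fun η => ∫ ξ, f ξ ∂(S r.toNNReal η)) p]
      exact (hL.hasDerivWithinAt_integral hS hC hr _).sub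
        (hL.hasDerivWithinAt_integral hS hC hr _))
    (fun p => by
      simp only [hS.zero, Real.toNNReal_zero, Kernel.id_apply, integral_dirac, Pi.zero_apply,
        sub_nonneg]
      exact hf (le_add_of_nonneg_right (Pi.single_nonneg.2 zero_le_one)))
    t.2 (η, z)
  simpa using key

lemma isAttractive_of_hasGenerator (hs : 1 / 2 ≤ s) {S : ℝ≥0 → Kernel (Config N) (Config N)}
    (hS : IsMarkovSemigroup S) (hL : HasGenerator S (harmonicGenerator N s)) :
    IsAttractive S := by
  have := hS.isMarkovKernel
  intro μ₁ μ₂ _ _ h t f _ ⟨C, hC⟩ hf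
  have hint : ∀ (μ : Measure (Config N)) [IsProbabilityMeasure μ],
      ∫ ξ, f ξ ∂(S t ∘ₘ μ) = ∫ η, ∫ ξ, f ξ ∂(S t η) ∂μ := by
    intro μ _
    have := Kernel.integral_comp (κ := Kernel.const Unit μ) (η := S t) (a := ())
      (integrable_of_abs_le hC)
    rwa [Kernel.comp_apply, Kernel.const_apply] at this
  rw [hint, hint]
  exact h _ Measurable.of_discrete ⟨C, fun η => abs_integral_le hC⟩
    (monotone_integral hs hS hL hC hf t)

end HarmonicModel

end InteractingParticles

end

theorem mainTheorem4 (N : ℕ) [NeZero N] (s : ℝ) (hs : 1 / 2 ≤ s) :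
    (∃! S : ℝ≥0 → Kernel (InteractingParticles.Config N) (InteractingParticles.Config N),
      InteractingParticles.IsMarkovSemigroup S ∧
        InteractingParticles.HasGenerator S (InteractingParticles.harmonicGenerator N s)) ∧
    ∀ S : ℝ≥0 → Kernel (InteractingParticles.Config N) (InteractingParticles.Config N),
      InteractingParticles.IsMarkovSemigroup S →
      InteractingParticles.HasGenerator S (InteractingParticles.harmonicGenerator N s) →
      InteractingParticles.IsAttractive S := by
  have hL := InteractingParticles.isJumpGenerator_harmonicGenerator (N := N) hs
  have hfin := InteractingParticles.finite_particleNumber_eq (N := N)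
  obtain ⟨S, hS, hSL⟩ := hL.exists_isMarkovSemigroup hfin
  exact ⟨⟨S, ⟨hS, hSL⟩, fun S' h =>
      InteractingParticles.IsMarkovSemigroup.eq_of_hasGenerator hL hfin h.1 h.2 hS hSL⟩,
    fun S hS hSL => InteractingParticles.isAttractive_of_hasGenerator hs hS hSL⟩
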